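/- Let $G$ be a group and let $H$ be a subnormal subgroup of $G$ of finite index. Let $H_G=\bigcap_{g\in G}gHg^{-1}$ be the largest normal subgroup of $G$ contained in $H$. For a subnormal subgroup $K$ of finite index in $G$, put $$d(G,K)=\sum_{i=0}^{n-1}\bigl([K_{i+1}:K_i]-1\bigr),$$ where $K=K_0\subset K_1\subset\cdots\subset K_n=G$ is any composition series from $K$ to $G$, that is, each $K_i$ is a maximal proper normal subgroup of $K_{i+1}$; such a series exists and the sum does not depend on its choice (for $K=G$ we have $n=0$ and $d(G,G)=0$). For a positive integer $n$ let $$f(n)=\sum_{p\mid n,\ p\text{ prime}}\operatorname{ord}_p(n)\,(p-1)$$ be the Mycielski function, where $\operatorname{ord}_p(n)$ is the largest integer $\alpha$ with $p^\alpha\mid n$. Then $[G:H_G]$ is finite, $$[G:H]\ \ge\ 1+d(G,H_G)\ \ge\ 1+f([G:H_G]),$$ and hence $$[G:H_G]\ \le\ 2^{[G:H]-1}.$$ -/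

import Mathlib

/-- `H` is a maximal normal subgroup of `K`: `H` is a proper subgroup of `K`, normal in `K`,
and the only normal subgroup of `K` properly containing `H` is `K` itself. -/
def IsMaximalNormalIn {G : Type*} [Group G] (H K : Subgroup G) : Prop :=
  H < K ∧ (H.subgroupOf K).Normal ∧
    ∀ N : Subgroup G, H < N → N ≤ K → (N.subgroupOf K).Normal → N = K

namespace IsMaximalNormalIn

variable {G : Type*} [Group G] {x y z : Subgroup G}

theorem le_normalizer (h : IsMaximalNormalIn x y) : y ≤ Subgroup.normalizer (x : Set G) :=
  (Subgroup.normal_subgroupOf_iff_le_normalizer h.1.le).1 h.2.1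

theorem sup_eq (hx : IsMaximalNormalIn x z) (hy : IsMaximalNormalIn y z) (hne : x ≠ y) :
    x ⊔ y = z := by
  have hle : x ⊔ y ≤ z := sup_le hx.1.le hy.1.le
  have hn : ((x ⊔ y).subgroupOf z).Normal := by
    rw [Subgroup.normal_subgroupOf_iff_le_normalizer hle]
    exact le_trans (le_inf hx.le_normalizer hy.le_normalizer)
      (Subgroup.normalizer_inf_normalizer_le_normalizer_sup x y)
  by_cases hxy : y ≤ x
  · exact absurd (hy.2.2 x (lt_of_le_of_ne hxy hne.symm) hx.1.le hx.2.1) hx.1.ne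
  · exact hx.2.2 _ (lt_of_le_of_ne le_sup_left fun h => hxy (by rw [h]; exact le_sup_right))
      hle hn

theorem inf_left (hy : IsMaximalNormalIn y (x ⊔ y)) : IsMaximalNormalIn (x ⊓ y) x := by
  have hxN : x ≤ Subgroup.normalizer (y : Set G) := le_sup_left.trans hy.le_normalizer
  refine ⟨lt_of_le_of_ne inf_le_left fun h => ?_, ?_, fun N hlt hle hN => ?_⟩
  · have : x ≤ y := by rw [← h]; exact inf_le_right
    exact hy.1.ne (sup_eq_right.2 this).symm
  · rw [Subgroup.normal_subgroupOf_iff_le_normalizer inf_le_left]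
    exact le_trans (le_inf Subgroup.le_normalizer hxN)
      Subgroup.inf_normalizer_le_normalizer_inf
  · rw [Subgroup.normal_subgroupOf_iff_le_normalizer hle] at hN
    have hNy : N ⊔ y ≤ x ⊔ y := sup_le_sup_right hle y
    have hnorm : ((N ⊔ y).subgroupOf (x ⊔ y)).Normal := by
      rw [Subgroup.normal_subgroupOf_iff_le_normalizer hNy]
      refine sup_le ?_ (le_sup_right.trans Subgroup.le_normalizer)
      exact le_trans (le_inf hN hxN) (Subgroup.normalizer_inf_normalizer_le_normalizer_sup N y)
    have hylt : y < N ⊔ y := lt_of_le_of_ne le_sup_right fun h =>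
      not_le_of_gt hlt (le_inf hle (by rw [h]; exact le_sup_left))
    have heq : N ⊔ y = x ⊔ y := hy.2.2 _ hylt hNy hnorm
    refine le_antisymm hle fun g hg => ?_
    have hg' : g ∈ ((N ⊔ y : Subgroup G) : Set G) := by
      rw [heq]; exact (le_sup_left : x ≤ x ⊔ y) hg
    rw [Subgroup.coe_mul_of_left_le_normalizer_right N y (hle.trans hxN)] at hg'
    obtain ⟨a, ha, b, hb, rfl⟩ := Set.mem_mul.1 hg'
    have hbx : b ∈ x := (Subgroup.mul_mem_cancel_left x (hle ha)).1 hg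
    exact N.mul_mem ha (hlt.le ⟨hbx, hb⟩)

theorem relIndex_eq (h : IsMaximalNormalIn x (x ⊔ y)) :
    x.relIndex (x ⊔ y) = (x ⊓ y).relIndex y := by
  have := h.2.1
  have e := Subgroup.relIndex_sup_left (H := y.subgroupOf (x ⊔ y)) (K := x.subgroupOf (x ⊔ y))
  rw [← Subgroup.subgroupOf_sup le_sup_left le_sup_right, Subgroup.subgroupOf_self,
    Subgroup.relIndex_top_right, Subgroup.relIndex_subgroupOf le_sup_right] at e
  rw [Subgroup.inf_relIndex_right, ← e]
  rfl

end IsMaximalNormalIn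

/-- With this instance, a `CompositionSeries (Subgroup G)` is a finite chain
`H₀ < H₁ < ⋯ < Hₙ` of subgroups of `G`, each one maximal normal in the next. -/
instance Subgroup.instJordanHolderLattice {G : Type*} [Group G] :
    JordanHolderLattice (Subgroup G) where
  IsMaximal := IsMaximalNormalIn
  lt_of_isMaximal h := h.1
  sup_eq_of_isMaximal := IsMaximalNormalIn.sup_eq
  isMaximal_inf_left_of_isMaximal_sup _ hy := hy.inf_left

/-- The sum of `[Hᵢ₊₁ : Hᵢ] - 1` over the steps of a composition series `H₀ < ⋯ < Hₙ`. -/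
noncomputable def compositionWeight {G : Type*} [Group G]
    (s : CompositionSeries (Subgroup G)) : ℕ :=
  ∑ i : Fin s.length, ((s i.castSucc).relIndex (s i.succ) - 1)

/-- There is a composition series from `H` to the whole group. -/
def HasCompositionSeries {G : Type*} [Group G] (H : Subgroup G) : Prop :=
  ∃ s : CompositionSeries (Subgroup G), s.head = H ∧ s.last = ⊤

open Classical in
/-- The distance `d(G, H)`: the sum of `[Hᵢ₊₁ : Hᵢ] - 1` over a composition series
`H = H₀ < ⋯ < Hₙ = G`. Such a series exists when `H` is subnormal of finite index
(`hasCompositionSeries_of_isSubnormal`), and the sum does not depend on the series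
(`compositionDist_eq`). -/
noncomputable def compositionDist {G : Type*} [Group G] (H : Subgroup G) : ℕ :=
  if h : HasCompositionSeries H then compositionWeight h.choose else 0

theorem compositionWeight_eq {G : Type*} [Group G] (s t : CompositionSeries (Subgroup G))
    (hb : s.head = t.head) (ht : s.last = t.last) :
    compositionWeight s = compositionWeight t := by
  obtain ⟨f, hf⟩ := CompositionSeries.jordan_holder s t hb ht
  refine Fintype.sum_equiv f _ _ fun i => ?_
  have := (hf i).rel (fun p q => p.1.relIndex p.2 = q.1.relIndex q.2) (fun {_} => rfl)
    (fun {_ _} h => h.symm) (fun {x y z} (h₁ : x.1.relIndex x.2 = y.1.relIndex y.2)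
      (h₂ : y.1.relIndex y.2 = z.1.relIndex z.2) => h₁.trans h₂)
    (fun {_ _} h => IsMaximalNormalIn.relIndex_eq h)
  exact congrArg (· - 1) this

theorem compositionDist_eq {G : Type*} [Group G] (H : Subgroup G)
    (s : CompositionSeries (Subgroup G)) (hb : s.head = H) (ht : s.last = ⊤) :
    compositionDist H = compositionWeight s := by
  have h : HasCompositionSeries H := ⟨s, hb, ht⟩
  rw [compositionDist, dif_pos h]
  exact compositionWeight_eq _ _ (h.choose_spec.1.trans hb.symm) (h.choose_spec.2.trans ht.symm)

theorem reflTransGen_of_normal {G : Type*} [Group G] (K : Subgroup G) (n : ℕ) :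
    ∀ H : Subgroup G, H ≤ K → (H.subgroupOf K).Normal → H.relIndex K = n → n ≠ 0 →
      Relation.ReflTransGen IsMaximalNormalIn H K := by
  induction n using Nat.strong_induction_on generalizing K with
  | _ n ih =>
  intro H hHK hN hn hn0
  rcases eq_or_lt_of_le hHK with rfl | hlt
  · exact .refl
  -- a normal subgroup `N` with `H ≤ N < K` of least index in `K`
  let P : ℕ → Prop := fun m => ∃ N : Subgroup G, H ≤ N ∧ N < K ∧ (N.subgroupOf K).Normal ∧
    N.relIndex K = m
  classical
  have hP : ∃ m, P m := ⟨_, H, le_rfl, hlt, hN, rfl⟩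
  obtain ⟨N, hHN, hNK, hNn, hNm⟩ := Nat.find_spec hP
  have hmul := Subgroup.relIndex_mul_relIndex H N K hHN hNK.le
  have hN0 : N.relIndex K ≠ 0 := fun h => hn0 (by rw [← hn, ← hmul, h, mul_zero])
  have hH0 : H.relIndex N ≠ 0 := fun h => hn0 (by rw [← hn, ← hmul, h, zero_mul])
  have hN1 : N.relIndex K ≠ 1 := fun h => not_le_of_gt hNK (Subgroup.relIndex_eq_one.1 h)
  have hmax : IsMaximalNormalIn N K := by
    refine ⟨hNK, hNn, fun M hNM hMK hMn => ?_⟩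
    by_contra hne
    have h1 := Nat.find_min' hP ⟨M, hHN.trans hNM.le, lt_of_le_of_ne hMK hne, hMn, rfl⟩
    rw [← hNm, ← Subgroup.relIndex_mul_relIndex N M K hNM.le hMK] at h1
    rw [← Subgroup.relIndex_mul_relIndex N M K hNM.le hMK] at hN0
    have h2 : N.relIndex M ≠ 1 := fun h => not_le_of_gt hNM (Subgroup.relIndex_eq_one.1 h)
    have h3 : N.relIndex M ≠ 0 := left_ne_zero_of_mul hN0
    have h4 : M.relIndex K ≠ 0 := right_ne_zero_of_mul hN0
    have h5 : 2 ≤ N.relIndex M := by omega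
    nlinarith [Nat.pos_of_ne_zero h4]
  refine .tail (ih (H.relIndex N) ?_ N H hHN ?_ rfl hH0) hmax
  · have h5 : 2 ≤ N.relIndex K := by omega
    nlinarith [Nat.pos_of_ne_zero hH0]
  · rw [Subgroup.normal_subgroupOf_iff_le_normalizer hHN]
    exact hNK.le.trans ((Subgroup.normal_subgroupOf_iff_le_normalizer hHK).1 hN)

theorem hasCompositionSeries_of_isSubnormal {G : Type*} [Group G] (H : Subgroup G)
    (hH : H.IsSubnormal) (hfin : H.FiniteIndex) : HasCompositionSeries H := by
  have key : Relation.ReflTransGen IsMaximalNormalIn H ⊤ := by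
    induction hH with
    | top => exact .refl
    | step H K hle _ hN ih =>
      have hK : K.FiniteIndex := Subgroup.finiteIndex_of_le hle
      refine .trans (reflTransGen_of_normal K _ H hle hN rfl fun h => ?_) (ih hK)
      exact hfin.index_ne_zero (by rw [← Subgroup.relIndex_mul_index hle, h, zero_mul])
  clear hH hfin
  induction key using Relation.ReflTransGen.head_induction_on with
  | refl => exact ⟨RelSeries.singleton _ ⊤, rfl, rfl⟩
  | @head a c hac _ ih =>
    obtain ⟨s, hs, ht⟩ := ih
    exact ⟨s.cons a (by rw [hs]; exact hac), s.head_cons _ _, (s.last_cons _ _).trans ht⟩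

/-- The Mycielski function `f(n) = ∑ ord_p(n) (p - 1)`, the sum over the prime divisors
`p` of `n`. -/
def mycielski (n : ℕ) : ℕ :=
  ∑ p ∈ n.primeFactors, padicValNat p n * (p - 1)

/-!
The lower bound for the index goes by induction along a subnormal chain from `H` to `G`, one step
`H ⊴ K` at a time. Put `q = [K : H]` and `m = [G : K]`. As `H` is normal in `K`, it has at most `m`
conjugates, one for each coset of `K`, and the core of `H` is the intersection of the core of `K`
with these conjugates. Intersecting a subgroup `L` of the core of `K` with a conjugate `gHg⁻¹`
raises the distance to `G` by at most `q - 1`: the intersection is normal in `L`, since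
`L ≤ gKg⁻¹`, and `[L : L ∩ gHg⁻¹] ≤ q`
(`compositionDist_inf_le`); here refining a normal step to a composition series only lowers its
weight, because `(a - 1) + (b - 1) ≤ ab - 1` (`compositionDist_le_of_normal`). So the distance of
the core of `H` is at most `(m - 1) + m (q - 1) = [G : H] - 1` (`compositionDist_normalCore_lt`).

The Mycielski function is additive on products and satisfies `f(n) ≤ n - 1` and `n ≤ 2 ^ f(n)`.
Summing the first inequality over a composition series gives `f([G : N]) ≤ d(G, N)`
(`mycielski_index_le_compositionDist`), and the second turns the bound on `f` into one on the index.
-/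

/-! ### The Mycielski function -/

theorem mycielski_one : mycielski 1 = 0 := by simp [mycielski]

theorem mycielski_eq_sum_factorization (n : ℕ) :
    mycielski n = n.factorization.sum fun p k => k * (p - 1) := by
  refine Finset.sum_congr (Nat.support_factorization n).symm fun p hp => ?_
  rw [Nat.factorization_def n (Nat.prime_of_mem_primeFactors
    (by rwa [← Nat.support_factorization]))]

theorem mycielski_mul {a b : ℕ} (ha : a ≠ 0) (hb : b ≠ 0) :
    mycielski (a * b) = mycielski a + mycielski b := by
  simp only [mycielski_eq_sum_factorization, Nat.factorization_mul ha hb]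
  exact Finsupp.sum_add_index' (fun _ => zero_mul _) fun _ _ _ => add_mul _ _ _

theorem mycielski_prime {p : ℕ} (hp : p.Prime) : mycielski p = p - 1 := by
  have := Fact.mk hp
  simp [mycielski, hp.primeFactors]

theorem pred_add_pred_le_mul_pred {a b : ℕ} (ha : a ≠ 0) (hb : b ≠ 0) :
    (a - 1) + (b - 1) ≤ a * b - 1 := by
  obtain ⟨a, rfl⟩ := Nat.exists_eq_succ_of_ne_zero ha
  obtain ⟨b, rfl⟩ := Nat.exists_eq_succ_of_ne_zero hb
  have : (a + 1) * (b + 1) = a * b + a + b + 1 := by ring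
  simp only [Nat.succ_eq_add_one, this]
  have := Nat.zero_le (a * b)
  omega

theorem mycielski_le_pred (n : ℕ) : mycielski n ≤ n - 1 := by
  induction n using induction_on_primes with
  | zero => simp [mycielski]
  | one => simp [mycielski]
  | prime_mul p a hp ih =>
    rcases eq_or_ne a 0 with rfl | ha
    · simp [mycielski]
    · rw [mycielski_mul hp.ne_zero ha, mycielski_prime hp]
      exact (Nat.add_le_add_left ih _).trans (pred_add_pred_le_mul_pred hp.ne_zero ha)

theorem le_two_pow_mycielski (n : ℕ) : n ≤ 2 ^ mycielski n := by
  induction n using induction_on_primes with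
  | zero => simp
  | one => simp [mycielski]
  | prime_mul p a hp ih =>
    rcases eq_or_ne a 0 with rfl | ha
    · simp
    · rw [mycielski_mul hp.ne_zero ha, mycielski_prime hp, pow_add]
      have h : p - 1 < 2 ^ (p - 1) := Nat.lt_two_pow_self
      exact Nat.mul_le_mul (by omega) ih

/-! ### The composition distance along normal steps -/

section

variable {G : Type*} [Group G]

theorem compositionWeight_cons (s : CompositionSeries (Subgroup G)) (a : Subgroup G)
    (ha : IsMaximalNormalIn a s.head) :
    compositionWeight (s.cons a ha) = (a.relIndex s.head - 1) + compositionWeight s := by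
  have hlen : s.length + 1 = (s.cons a ha).length := by simp
  rw [compositionWeight, ← Equiv.sum_comp (finCongr hlen), Fin.sum_univ_succ]
  congr 1
  refine Finset.sum_congr rfl fun i _ => ?_
  have h1 := RelSeries.cons_cast_succ s a ha i.castSucc
  have h2 := RelSeries.cons_cast_succ s a ha i.succ
  exact congrArg₂ (fun x y : Subgroup G => x.relIndex y - 1) h1 h2

theorem hasCompositionSeries_top : HasCompositionSeries (⊤ : Subgroup G) :=
  ⟨RelSeries.singleton _ ⊤, rfl, rfl⟩

theorem compositionDist_top : compositionDist (⊤ : Subgroup G) = 0 := by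
  rw [compositionDist_eq ⊤ (RelSeries.singleton _ ⊤) rfl rfl]
  exact Finset.sum_empty

theorem IsMaximalNormalIn.hasCompositionSeries {a c : Subgroup G} (h : IsMaximalNormalIn a c)
    (hc : HasCompositionSeries c) : HasCompositionSeries a := by
  obtain ⟨s, rfl, ht⟩ := hc
  exact ⟨s.cons a h, s.head_cons _ _, (s.last_cons _ _).trans ht⟩

theorem IsMaximalNormalIn.compositionDist_eq {a c : Subgroup G} (h : IsMaximalNormalIn a c)
    (hc : HasCompositionSeries c) :
    compositionDist a = (a.relIndex c - 1) + compositionDist c := by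
  obtain ⟨s, rfl, ht⟩ := hc
  rw [_root_.compositionDist_eq s.head s rfl ht, ← compositionWeight_cons s a h]
  exact _root_.compositionDist_eq a _ (s.head_cons _ _) ((s.last_cons _ _).trans ht)

/-- A normal step of finite index raises the distance to `G` by at most its index minus one; it
need not be maximal. -/
theorem compositionDist_le_of_normal {H K : Subgroup G} (hHK : H ≤ K)
    (hN : (H.subgroupOf K).Normal) (h0 : H.relIndex K ≠ 0) (hK : HasCompositionSeries K) :
    HasCompositionSeries H ∧ compositionDist H ≤ compositionDist K + (H.relIndex K - 1) := by
  have key := reflTransGen_of_normal K _ H hHK hN rfl h0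
  suffices H ≤ K ∧ HasCompositionSeries H ∧
      compositionDist H ≤ compositionDist K + (H.relIndex K - 1) from this.2
  clear hHK hN
  induction key using Relation.ReflTransGen.head_induction_on with
  | refl => exact ⟨le_rfl, hK, Nat.le_add_right _ _⟩
  | @head a c hac _ ih =>
    obtain ⟨hcK, hc, hle⟩ := ih fun h =>
      h0 (Nat.eq_zero_of_zero_dvd (h ▸ Subgroup.relIndex_dvd_of_le_left K hac.1.le))
    have hmul := Subgroup.relIndex_mul_relIndex a c K hac.1.le hcK
    rw [← hmul] at h0
    refine ⟨hac.1.le.trans hcK, hac.hasCompositionSeries hc, ?_⟩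
    rw [hac.compositionDist_eq hc, ← hmul]
    have := pred_add_pred_le_mul_pred (left_ne_zero_of_mul h0) (right_ne_zero_of_mul h0)
    omega

theorem mycielski_index_le_compositionDist (N : Subgroup G) [hN : N.Normal] [N.FiniteIndex] :
    mycielski N.index ≤ compositionDist N := by
  have h0 : N.index ≠ 0 := Subgroup.FiniteIndex.index_ne_zero
  have key := reflTransGen_of_normal ⊤ N.index N le_top inferInstance N.relIndex_top_right h0
  suffices HasCompositionSeries N ∧ mycielski N.index ≤ compositionDist N from this.2
  clear hN
  induction key using Relation.ReflTransGen.head_induction_on with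
  | refl => exact ⟨hasCompositionSeries_top, by rw [Subgroup.index_top, mycielski_one]; simp⟩
  | @head a c hac _ ih =>
    have hmul := Subgroup.relIndex_mul_index hac.1.le
    rw [← hmul] at h0
    have : c.FiniteIndex := ⟨right_ne_zero_of_mul h0⟩
    obtain ⟨hc, hle⟩ := ih (right_ne_zero_of_mul h0)
    refine ⟨hac.hasCompositionSeries hc, ?_⟩
    rw [hac.compositionDist_eq hc, ← hmul,
      mycielski_mul (left_ne_zero_of_mul h0) (right_ne_zero_of_mul h0)]
    exact Nat.add_le_add (mycielski_le_pred _) hle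

/-! ### Intersections of conjugates and the normal core -/

/-- Intersecting with a conjugate of `H` costs at most `[K : H] - 1`. The conjugate `g⁻¹Hg` is
encoded as the preimage of `H` under conjugation by `g`. -/
theorem compositionDist_inf_le {H K L : Subgroup G} (hN : (H.subgroupOf K).Normal)
    (h0 : H.relIndex K ≠ 0) (hLK : L ≤ K.normalCore) (hL : HasCompositionSeries L) (g : G) :
    HasCompositionSeries (L ⊓ H.comap (MulAut.conj g).toMonoidHom) ∧
    compositionDist (L ⊓ H.comap (MulAut.conj g).toMonoidHom) ≤
      compositionDist L + (H.relIndex K - 1) := by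
  set H' := H.comap (MulAut.conj g).toMonoidHom
  have hmap : L.map (MulAut.conj g).toMonoidHom ≤ K := by
    rintro _ ⟨x, hx, rfl⟩
    exact hLK hx g
  have hind : (L ⊓ H').relIndex L = H.relIndex (L.map (MulAut.conj g).toMonoidHom) := by
    rw [Subgroup.inf_relIndex_left, Subgroup.relIndex_comap]
  have hle : (L ⊓ H').relIndex L ≤ H.relIndex K :=
    hind.trans_le (Subgroup.relIndex_le_of_le_right hmap h0)
  have hne : (L ⊓ H').relIndex L ≠ 0 := fun h =>
    h0 (Subgroup.relIndex_eq_zero_of_le_right hmap (hind.symm.trans h))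
  have hnorm : ((L ⊓ H').subgroupOf L).Normal := by
    refine ⟨fun x hx y => ?_⟩
    have hx' : MulAut.conj g x ∈ H := (Subgroup.mem_subgroupOf.1 hx).2
    refine Subgroup.mem_subgroupOf.2 ⟨(y * x * y⁻¹).2, ?_⟩
    have h := hN.conj_mem ⟨_, hLK x.2 g⟩ (Subgroup.mem_subgroupOf.2 hx') ⟨_, hLK y.2 g⟩
    have h' := Subgroup.mem_subgroupOf.1 h
    change MulAut.conj g (y * x * y⁻¹) ∈ H
    simpa [mul_assoc] using h'
  obtain ⟨h1, h2⟩ := compositionDist_le_of_normal inf_le_left hnorm hne hL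
  exact ⟨h1, by omega⟩

theorem compositionDist_inf_iInf_le {H K L : Subgroup G} (hN : (H.subgroupOf K).Normal)
    (h0 : H.relIndex K ≠ 0) (hLK : L ≤ K.normalCore) (hL : HasCompositionSeries L)
    {ι : Type*} (s : Finset ι) (g : ι → G) :
    HasCompositionSeries (L ⊓ ⨅ i ∈ s, H.comap (MulAut.conj (g i)).toMonoidHom) ∧
    compositionDist (L ⊓ ⨅ i ∈ s, H.comap (MulAut.conj (g i)).toMonoidHom) ≤
      compositionDist L + s.card * (H.relIndex K - 1) := by
  classical
  induction s using Finset.induction_on with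
  | empty => simpa using hL
  | insert a s ha ih =>
    have h := compositionDist_inf_le hN h0 (inf_le_left.trans hLK) ih.1 (g a)
    rw [inf_assoc, inf_comm (⨅ i ∈ s, _),
      ← Finset.iInf_insert a s fun i => H.comap (MulAut.conj (g i)).toMonoidHom] at h
    refine ⟨h.1, ?_⟩
    rw [Finset.card_insert_of_notMem ha, add_mul, one_mul]
    have := ih.2
    omega

/-- When `H` is normal in `K`, one conjugate of `H` for each left coset of `K` suffices to
cut out the core of `H`. -/
theorem normalCore_eq_inf_iInf_conj {H K : Subgroup G} (hHK : H ≤ K)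
    (hN : (H.subgroupOf K).Normal) :
    H.normalCore = K.normalCore ⊓
      ⨅ q : G ⧸ K, H.comap (MulAut.conj (Quotient.out q)⁻¹).toMonoidHom := by
  refine le_antisymm (le_inf (Subgroup.normalCore_mono hHK)
    (le_iInf fun q x hx => hx _)) fun x hx b => ?_
  obtain ⟨k, hk⟩ := QuotientGroup.mk_out_eq_mul K b⁻¹
  have hx2 := Subgroup.mem_iInf.1 hx.2 (b⁻¹ : G)
  have hx3 : (b⁻¹ * k : G)⁻¹ * x * (b⁻¹ * k : G)⁻¹⁻¹ ∈ H := by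
    rw [← hk]
    exact hx2
  have h := hN.conj_mem ⟨_, hHK hx3⟩ (Subgroup.mem_subgroupOf.2 hx3) k
  have h' := Subgroup.mem_subgroupOf.1 h
  simpa [mul_assoc] using h'

theorem compositionDist_normalCore_lt (H : Subgroup G) (hH : H.IsSubnormal)
    (hfin : H.FiniteIndex) : compositionDist H.normalCore < H.index := by
  suffices HasCompositionSeries H.normalCore ∧ compositionDist H.normalCore < H.index from this.2
  induction hH with
  | top =>
    rw [Subgroup.normalCore_eq_self, compositionDist_top, Subgroup.index_top]
    exact ⟨hasCompositionSeries_top, one_pos⟩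
  | step H K hle _ hN ih =>
    have hK : K.FiniteIndex := Subgroup.finiteIndex_of_le hle
    obtain ⟨hc, hlt⟩ := ih hK
    have hmul := Subgroup.relIndex_mul_index hle
    have h0 : H.relIndex K ≠ 0 := left_ne_zero_of_mul (hmul ▸ hfin.index_ne_zero)
    have := Fintype.ofFinite (G ⧸ K)
    have key := compositionDist_inf_iInf_le hN h0 le_rfl hc Finset.univ
      fun q : G ⧸ K => (Quotient.out q)⁻¹
    simp only [Finset.mem_univ, iInf_pos, ← normalCore_eq_inf_iInf_conj hle hN,
      Finset.card_univ, ← Nat.card_eq_fintype_card] at key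
    refine ⟨key.1, key.2.trans_lt ?_⟩
    change _ + K.index * _ < _
    rw [← hmul]
    obtain ⟨q, hq⟩ := Nat.exists_eq_succ_of_ne_zero h0
    rw [hq, Nat.succ_mul, Nat.succ_sub_one, mul_comm q]
    omega

end

theorem corollary3p1 {G : Type*} [Group G] (H : Subgroup G)
    (hH : H.IsSubnormal) (hfin : H.FiniteIndex) :
    H.normalCore.FiniteIndex ∧
    1 + compositionDist H.normalCore ≤ H.index ∧
    1 + mycielski H.normalCore.index ≤ 1 + compositionDist H.normalCore ∧
    H.normalCore.index ≤ 2 ^ (H.index - 1) := by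
  have hd := compositionDist_normalCore_lt H hH hfin
  have hf := mycielski_index_le_compositionDist H.normalCore
  refine ⟨inferInstance, by omega, by omega, (le_two_pow_mycielski _).trans ?_⟩
  exact Nat.pow_le_pow_right two_pos (by omega)
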